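/- An arithmetical structure on a finite, connected, simple graph $G$ consists of nonnegative integers $d_v$ and positive integers $r_v$ $(v\in V(G))$, the $r_v$ having no common factor greater than $1$, such that $r_vd_v=\sum_{u\sim v}r_u$ for every vertex $v$. Its critical group is the torsion subgroup of the cokernel $\mathbb{Z}^{V(G)}/\operatorname{im}(L)$ of the matrix $L=\operatorname{diag}(\mathbf d)-A(G)$, where $A(G)$ is the adjacency matrix. Let $S_n$ be the star graph with $n$ leaves $v_1,\dots,v_n$ attached to one central vertex $v_0$, and let $K_n$ be the complete graph on $n$ vertices. An invariant factor decomposition with $k$ components of an abelian group $A$ is an isomorphism $A\cong\bigoplus_{i=1}^{k}\mathbb{Z}/a_i\mathbb{Z}$ with integers $a_i>1$ and $a_i\mid a_{i+1}$ for $1\le i<k$. Proposition 4.5. Let $n\ge 2$. The critical group of any arithmetical structure on $S_n$ or on $K_n$ has an invariant factor decomposition, and every such decomposition has at most $n-2$ components. This bound is sharp, for both families and for every $n\geq 2$: the Laplacian arithmetical structure on $K_n$ ($d_v=n-1$ and $r_v=1$ for all $v$) has critical group isomorphic to $(\mathbb{Z}/n\mathbb{Z})^{n-2}$, and so does the arithmetical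 structure on $S_n$ with $d_0=1$, $r_0=n$ at the central vertex and $d_i=n$, $r_i=1$ at each leaf. -/

import Mathlib

/-- An arithmetical structure on a finite simple graph `G`: nonnegative integers `d v` and positive
integers `r v`, the latter without a common factor, such that `r v * d v` is the sum of the `r u`
over the neighbours `u` of `v`. -/
structure ArithmeticalStructure {V : Type*} [Fintype V] (G : SimpleGraph V)
    [DecidableRel G.Adj] where
  d : V → ℕ
  r : V → ℕ
  r_pos : ∀ v, 0 < r v
  r_mul_d : ∀ v, r v * d v = ∑ u ∈ G.neighborFinset v, r u
  gcd_r : Finset.univ.gcd r = 1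

namespace ArithmeticalStructure

variable {V : Type*} [Fintype V] [DecidableEq V] {G : SimpleGraph V} [DecidableRel G.Adj]

/-- The matrix `L(G, d) = diag(d) - A(G)`. -/
def matrix (s : ArithmeticalStructure G) : Matrix V V ℤ :=
  Matrix.diagonal (fun v => (s.d v : ℤ)) - G.adjMatrix ℤ

/-- The cokernel of `L(G, d)` as a map `ℤ^V → ℤ^V`. -/
abbrev Cokernel (s : ArithmeticalStructure G) : Type _ :=
  (V → ℤ) ⧸ LinearMap.range s.matrix.mulVecLin

/-- The critical group: the torsion part of the cokernel of `L(G, d)`. -/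
abbrev CriticalGroup (s : ArithmeticalStructure G) : Type _ :=
  Submodule.torsion ℤ s.Cokernel

end ArithmeticalStructure

/-- `a 0, …, a (k-1)` is an invariant factor decomposition, with `k` components, of the abelian
group `A`: the `a i` are integers greater than `1`, each divides the next one, and `A` is isomorphic
to the direct sum of the cyclic groups `ℤ/(a i)ℤ`. -/
structure IsInvariantFactorDecomposition (A : Type*) [AddCommGroup A] {k : ℕ} (a : Fin k → ℕ) :
    Prop where
  one_lt : ∀ i, 1 < a i
  dvd : ∀ i j, i ≤ j → a i ∣ a j
  equiv : Nonempty (A ≃+ ((i : Fin k) → ZMod (a i)))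

/-!
The cokernel `C` of `L(G, d)` carries the degree `x ↦ ∑ v, r v * x v`, which is well defined because
`L(G, d)` is symmetric and kills `r`, and is onto `ℤ` because the `r v` have no common factor. The
degree vanishes on torsion and the torsion is a direct summand, so `C` maps onto
`CriticalGroup × ℤ` (`ArithmeticalStructure.exists_surjective_prod`). If the critical group has
`k > 0` invariant factors and `p` is a prime divisor of the first, then `C` maps onto `𝔽_p ^ (k + 1)`,
so any set of generators of `C` has at least `k + 1` elements
(`ArithmeticalStructure.lt_card_of_span_sup_range_eq_top`).
On the other hand the relation `L e_v` expresses the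
basis vector at a neighbour `u` of `v` through those at `v` and at its other neighbours. On the
complete graph this makes one basis vector superfluous; on the star graph a leaf yields the centre,
and then the centre yields another leaf, so two are superfluous. In both cases `n - 1` generators
remain, and `k ≤ n - 2`.

A decomposition exists because the critical group is a finite abelian group: starting from any
product of cyclic groups, the factors are inserted one by one in a chain of invariant factors by
means of `ℤ/a × ℤ/b ≅ ℤ/gcd × ℤ/lcm`.

For the two extremal structures, the isomorphism of the critical group with `(ℤ/n)^(n-2)` sends a
vector `x` of degree zero to the differences `x i - x 0` modulo `n`, where `i` runs through all
vertices (all leaves, for the star graph) but the first, numbered `0` here, and the last.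
-/

/-! ### Invariant factors of finite abelian groups -/

/-- With `g = gcd a b = u a + v b`, `a = g a'` and `b = g b'`, the isomorphism is given by the
unimodular matrix with rows `(1, 1)` and `(-v b', u a')`. -/
theorem ZMod.nonempty_prod_addEquiv_gcd_lcm (a b : ℕ) (ha : 0 < a) :
    Nonempty (ZMod a × ZMod b ≃+ ZMod (a.gcd b) × ZMod (a.lcm b)) := by
  have hg : 0 < a.gcd b := Nat.gcd_pos_of_pos_left _ ha
  obtain ⟨a', ha'⟩ := Nat.gcd_dvd_left a b
  obtain ⟨b', hb'⟩ := Nat.gcd_dvd_right a b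
  have hl := Nat.gcd_mul_lcm a b
  have hbez := Nat.gcd_eq_gcd_ab a b
  generalize a.gcdA b = u at hbez
  generalize a.gcdB b = v at hbez
  generalize a.gcd b = g at *
  generalize a.lcm b = l at *
  have hlb : l = a * b' := by
    apply Nat.eq_of_mul_eq_mul_left hg
    rw [hl]; conv_lhs => rw [hb']
    ring
  have hla : l = a' * b := by
    apply Nat.eq_of_mul_eq_mul_left hg
    rw [hl]; conv_lhs => rw [ha']
    ring
  have hone : u * a' + v * b' = 1 := by
    have hg' : (g : ℤ) ≠ 0 := by exact_mod_cast hg.ne'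
    apply mul_left_cancel₀ hg'
    have h1 : (a : ℤ) = g * a' := by exact_mod_cast ha'
    have h2 : (b : ℤ) = g * b' := by exact_mod_cast hb'
    rw [mul_one]
    conv_rhs => rw [hbez, h1, h2]
    ring
  have eag : (a : ZMod g) = 0 := (ZMod.natCast_eq_zero_iff _ _).2 ⟨_, ha'⟩
  have ebg : (b : ZMod g) = 0 := (ZMod.natCast_eq_zero_iff _ _).2 ⟨_, hb'⟩
  have ela : (b' : ZMod l) * a = 0 := by
    rw [mul_comm, ← Nat.cast_mul, ← hlb, ZMod.natCast_self]
  have elb : (a' : ZMod l) * b = 0 := by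
    rw [← Nat.cast_mul, ← hla, ZMod.natCast_self]
  have eal : (l : ZMod a) = 0 := (ZMod.natCast_eq_zero_iff _ _).2 ⟨_, hlb⟩
  have ebl : (l : ZMod b) = 0 := (ZMod.natCast_eq_zero_iff _ _).2 ⟨a', by rw [hla, mul_comm]⟩
  have ega : (a' : ZMod a) * g = 0 := by
    rw [mul_comm, ← Nat.cast_mul, ← ha', ZMod.natCast_self]
  have egb : (b' : ZMod b) * g = 0 := by
    rw [mul_comm, ← Nat.cast_mul, ← hb', ZMod.natCast_self]
  -- `cyc m p q` is the homomorphism from `ℤ` sending `1` to `(p, q)`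
  let cyc : ∀ m n : ℕ, ℤ → ℤ → (ℤ →+ ZMod m × ZMod n) := fun m n p q =>
    ((Int.castAddHom (ZMod m)).comp (AddMonoidHom.mulLeft p)).prod
      ((Int.castAddHom (ZMod n)).comp (AddMonoidHom.mulLeft q))
  let f : ZMod a × ZMod b →+ ZMod g × ZMod l :=
    (ZMod.lift a ⟨cyc g l 1 (-(v * b')), by simp [cyc, eag, mul_assoc, ela]⟩).coprod
      (ZMod.lift b ⟨cyc g l 1 (u * a'), by simp [cyc, ebg, mul_assoc, elb]⟩)
  let h : ZMod g × ZMod l →+ ZMod a × ZMod b :=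
    (ZMod.lift g ⟨cyc a b (u * a') (v * b'), by simp [cyc, mul_assoc, ega, egb]⟩).coprod
      (ZMod.lift l ⟨cyc a b (-1) 1, by simp [cyc, eal, ebl]⟩)
  have hf : ∀ x y : ℤ, f ((x : ZMod a), (y : ZMod b)) =
      (((x + y : ℤ) : ZMod g), ((-(v * b') * x + u * a' * y : ℤ) : ZMod l)) := by
    intro x y; simp [f, cyc]
  have hh : ∀ x y : ℤ, h ((x : ZMod g), (y : ZMod l)) =
      (((u * a' * x - y : ℤ) : ZMod a), ((v * b' * x + y : ℤ) : ZMod b)) := by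
    intro x y; simp [h, cyc, sub_eq_add_neg]
  refine ⟨AddEquiv.mk' ⟨f, h, ?_, ?_⟩ f.map_add⟩
  · rintro ⟨x, y⟩
    obtain ⟨x, rfl⟩ := ZMod.intCast_surjective x
    obtain ⟨y, rfl⟩ := ZMod.intCast_surjective y
    rw [hf, hh]
    congr 2
    · linear_combination x * hone
    · linear_combination y * hone
  · rintro ⟨x, y⟩
    obtain ⟨x, rfl⟩ := ZMod.intCast_surjective x
    obtain ⟨y, rfl⟩ := ZMod.intCast_surjective y
    rw [hh, hf]
    congr 2
    · linear_combination x * hone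
    · linear_combination y * hone

/-- Inserting a cyclic factor in a chain of invariant factors: the head `a₀` is replaced by
`gcd x a₀`, which is dropped if it is `1`, and `lcm x a₀` is inserted in the tail. That common
divisors of `x` and the `a i` divide the new factors keeps the head a divisor of the new tail. -/
theorem exists_invariantFactors_insert (k : ℕ) (a : Fin k → ℕ) (ha : ∀ i, 1 < a i)
    (hdvd : ∀ i j, i ≤ j → a i ∣ a j) (x : ℕ) (hx : 1 < x) :
    ∃ (l : ℕ) (b : Fin l → ℕ), (∀ m, m ∣ x → (∀ i, m ∣ a i) → ∀ j, m ∣ b j) ∧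
      IsInvariantFactorDecomposition (ZMod x × ((i : Fin k) → ZMod (a i))) b := by
  induction k generalizing x with
  | zero =>
    refine ⟨1, fun _ => x, fun m hm _ _ => hm, fun _ => hx, fun _ _ _ => dvd_rfl, ⟨?_⟩⟩
    exact AddEquiv.prodUnique.trans (LinearEquiv.funUnique (Fin 1) ℤ (ZMod x)).symm.toAddEquiv
  | succ k ih =>
    have hl : 1 < x.lcm (a 0) :=
      hx.trans_le (Nat.le_of_dvd (Nat.lcm_pos (by omega) (by have := ha 0; omega))
        (Nat.dvd_lcm_left _ _))
    obtain ⟨l, b, hb, hlt, hbd, ⟨e⟩⟩ := ih (fun i => a i.succ) (fun i => ha _)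
      (fun i j hij => hdvd _ _ (Fin.succ_le_succ_iff.2 hij)) _ hl
    obtain ⟨e₀⟩ := ZMod.nonempty_prod_addEquiv_gcd_lcm x (a 0) (by omega)
    let e₁ : (ZMod x × ((i : Fin (k + 1)) → ZMod (a i))) ≃+
        ZMod (x.gcd (a 0)) × ((j : Fin l) → ZMod (b j)) :=
      ((AddEquiv.refl _).prodCongr
        (Fin.consLinearEquiv ℤ fun i => ZMod (a i)).symm.toAddEquiv).trans <|
      AddEquiv.prodAssoc.symm.trans <|
      (e₀.prodCongr (AddEquiv.refl _)).trans <|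
      AddEquiv.prodAssoc.trans <| (AddEquiv.refl _).prodCongr e
    have hgb : ∀ j, x.gcd (a 0) ∣ b j := hb _
      ((Nat.gcd_dvd_left _ _).trans (Nat.dvd_lcm_left _ _))
      (fun i => (Nat.gcd_dvd_right _ _).trans (hdvd _ _ (Fin.zero_le _)))
    have hmb : ∀ m, m ∣ x → (∀ i, m ∣ a i) → ∀ j, m ∣ b j := fun m hm hma =>
      hb m (hm.trans (Nat.dvd_lcm_left _ _)) (fun i => hma _)
    by_cases hg : x.gcd (a 0) = 1
    · refine ⟨l, b, hmb, hlt, hbd, ⟨e₁.trans ?_⟩⟩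
      have : Subsingleton (ZMod (x.gcd (a 0))) := by rw [hg]; infer_instance
      have : Unique (ZMod (x.gcd (a 0))) := Unique.mk' _
      exact AddEquiv.uniqueProd
    · have hpos : 0 < x.gcd (a 0) := Nat.gcd_pos_of_pos_left _ (by omega)
      refine ⟨l + 1, Fin.cons (x.gcd (a 0)) b, ?_, ?_, ?_, ⟨e₁.trans ?_⟩⟩
      · intro m hm hma j
        refine Fin.cases ?_ (fun j => ?_) j
        · simpa using Nat.dvd_gcd hm (hma 0)
        · simpa using hmb m hm hma j
      · intro j
        refine Fin.cases ?_ (fun j => ?_) j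
        · simp only [Fin.cons_zero]; omega
        · simpa using hlt j
      · intro i j
        refine Fin.cases (fun _ => ?_) (fun i => ?_) i
        · refine Fin.cases ?_ (fun j => ?_) j
          · simp
          · simpa using hgb j
        · refine Fin.cases (fun h => ?_) (fun j h => ?_) j
          · simp at h
          · simpa using hbd i j (Fin.succ_le_succ_iff.1 h)
      · exact (Fin.consLinearEquiv ℤ fun i =>
          ZMod ((Fin.cons (x.gcd (a 0)) b : Fin (l + 1) → ℕ) i)).toAddEquiv

theorem exists_invariantFactors_pi (k : ℕ) (m : Fin k → ℕ) (hm : ∀ i, 1 < m i) :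
    ∃ (l : ℕ) (b : Fin l → ℕ),
      IsInvariantFactorDecomposition ((i : Fin k) → ZMod (m i)) b := by
  induction k with
  | zero => exact ⟨0, m, hm, fun i => i.elim0, ⟨AddEquiv.refl _⟩⟩
  | succ k ih =>
    obtain ⟨l, a, ha, hd, ⟨e⟩⟩ := ih (fun i => m i.succ) (fun i => hm _)
    obtain ⟨l', b, -, hb, hbd, ⟨e'⟩⟩ := exists_invariantFactors_insert l a ha hd (m 0) (hm 0)
    exact ⟨l', b, hb, hbd, ⟨(Fin.consLinearEquiv ℤ fun i => ZMod (m i)).symm.toAddEquiv.trans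
      (((AddEquiv.refl _).prodCongr e).trans e')⟩⟩

/-- The existence half of the structure theorem for finite abelian groups in invariant factor
form. -/
theorem exists_invariantFactors_of_finite (A : Type*) [AddCommGroup A] [Finite A] :
    ∃ (k : ℕ) (a : Fin k → ℕ), IsInvariantFactorDecomposition A a := by
  classical
  obtain ⟨ι, _, m, hm, ⟨e⟩⟩ := AddCommGroup.equiv_directSum_zmod_of_finite' A
  let σ := Fintype.equivFin ι
  obtain ⟨k, a, ha, hd, ⟨e'⟩⟩ := exists_invariantFactors_pi _ (fun i => m (σ.symm i))
    (fun i => hm _)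
  exact ⟨k, a, ha, hd, ⟨(e.trans (DirectSum.addEquivProd _)).trans
    ((LinearEquiv.piCongrLeft ℤ (fun i => ZMod (m i)) σ.symm).symm.toAddEquiv.trans e')⟩⟩

/-! ### The cokernel and its torsion -/

namespace ArithmeticalStructure

variable {V : Type*} [Fintype V] [DecidableEq V] {G : SimpleGraph V} [DecidableRel G.Adj]

theorem matrix_mulVec_apply (s : ArithmeticalStructure G) (x : V → ℤ) (v : V) :
    s.matrix.mulVec x v = s.d v * x v - ∑ u ∈ G.neighborFinset v, x u := by
  simp [matrix, Matrix.sub_mulVec, Matrix.mulVec_diagonal]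

/-- The degree `x ↦ ∑ v, r v * x v` of an integer vector on the vertices. -/
def degree (s : ArithmeticalStructure G) : (V → ℤ) →ₗ[ℤ] ℤ :=
  ∑ v, (s.r v : ℤ) • LinearMap.proj v

omit [DecidableEq V] in
theorem degree_apply (s : ArithmeticalStructure G) (x : V → ℤ) :
    s.degree x = ∑ v, (s.r v : ℤ) * x v := by
  simp [degree]

/-- Every element of the image has degree zero, because `L(G, d)` is symmetric and kills `r`. -/
theorem range_le_ker_degree (s : ArithmeticalStructure G) :
    LinearMap.range s.matrix.mulVecLin ≤ LinearMap.ker s.degree := by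
  rintro _ ⟨x, rfl⟩
  have hr : s.matrix.mulVec (fun v => (s.r v : ℤ)) = 0 := by
    funext v
    rw [matrix_mulVec_apply, mul_comm]
    have := s.r_mul_d v
    simp only [Pi.zero_apply, sub_eq_zero]
    exact_mod_cast this
  have hsymm : s.matrix.transpose = s.matrix := by
    simp [matrix, Matrix.transpose_sub, SimpleGraph.transpose_adjMatrix]
  have : (fun v => (s.r v : ℤ)) ⬝ᵥ s.matrix.mulVec x = 0 := by
    rw [Matrix.dotProduct_mulVec, ← Matrix.mulVec_transpose, hsymm, hr, zero_dotProduct]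
  simpa [degree_apply, dotProduct] using this

theorem degree_surjective (s : ArithmeticalStructure G) : Function.Surjective s.degree := by
  rw [← LinearMap.range_eq_top]
  obtain ⟨c, hc⟩ := (inferInstance :
    (LinearMap.range s.degree : Ideal ℤ).IsPrincipal).principal
  have hr : ∀ v, (s.r v : ℤ) ∈ Ideal.span {c} := fun v => by
    rw [Ideal.span, ← hc]
    exact ⟨Pi.single v 1, by simp [degree_apply, Pi.single_apply]⟩
  have hdvd : c.natAbs ∣ 1 := by
    rw [← s.gcd_r]
    exact Finset.dvd_gcd fun v _ =>
      Int.natAbs_dvd_natAbs.2 (Ideal.mem_span_singleton.1 (hr v))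
  rw [hc]
  exact Ideal.span_singleton_eq_top.2 (Int.isUnit_iff_natAbs_eq.2 (Nat.dvd_one.1 hdvd))

/-- The map induced by the degree on the cokernel. -/
def cokernelDegree (s : ArithmeticalStructure G) : s.Cokernel →ₗ[ℤ] ℤ :=
  Submodule.liftQ _ s.degree s.range_le_ker_degree

theorem cokernelDegree_of_torsion (s : ArithmeticalStructure G) (t : s.CriticalGroup) :
    s.cokernelDegree t = 0 := by
  obtain ⟨n, hn⟩ := (Submodule.mem_torsion_iff _).1 t.2
  have := congrArg s.cokernelDegree hn
  rw [Submonoid.smul_def, map_smul, map_zero, smul_eq_mul] at this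
  exact (mul_eq_zero.1 this).resolve_left (nonZeroDivisors.ne_zero n.2)

instance finite_criticalGroup (s : ArithmeticalStructure G) : Finite s.CriticalGroup :=
  Module.finite_of_fg_torsion _ Submodule.torsion_isTorsion

/-- The torsion of the cokernel is a direct summand, and it is killed by the degree, so a
retraction on it and the degree are together surjective. -/
theorem exists_surjective_prod (s : ArithmeticalStructure G) :
    ∃ f : (V → ℤ) →ₗ[ℤ] s.CriticalGroup × ℤ, Function.Surjective f ∧
      LinearMap.range s.matrix.mulVecLin ≤ LinearMap.ker f := by
  let T := Submodule.torsion ℤ s.Cokernel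
  have : Module.IsTorsionFree ℤ (s.Cokernel ⧸ T) :=
    Submodule.QuotientTorsion.instIsTorsionFree
  obtain ⟨σ, hσ⟩ := LinearMap.exists_rightInverse_of_surjective T.mkQ T.range_mkQ
  -- a section of `C → C / T` gives the retraction `1 - σ ∘ mkQ` on `T`
  obtain ⟨π, hπ⟩ : ∃ π : s.Cokernel →ₗ[ℤ] T, ∀ t : T, π t = t := by
    refine ⟨LinearMap.codRestrict T (LinearMap.id - σ ∘ₗ T.mkQ) fun c => ?_, fun t => ?_⟩
    · rw [← Submodule.Quotient.mk_eq_zero]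
      have := LinearMap.congr_fun hσ (T.mkQ c)
      simp only [LinearMap.comp_apply, Submodule.mkQ_apply, LinearMap.id_apply] at this
      simp [this]
    · have ht : T.mkQ (t : s.Cokernel) = 0 := (Submodule.Quotient.mk_eq_zero _).2 t.2
      apply Subtype.ext
      simp [-Submodule.mkQ_apply, ht]
  refine ⟨(π.prod s.cokernelDegree) ∘ₗ
    Submodule.mkQ (LinearMap.range s.matrix.mulVecLin), ?_, ?_⟩
  · rw [LinearMap.coe_comp]
    refine Function.Surjective.comp ?_ (Submodule.mkQ_surjective _)
    rintro ⟨t, z⟩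
    obtain ⟨x, hx⟩ := s.degree_surjective z
    obtain ⟨c, hc⟩ : ∃ c, s.cokernelDegree c = z := ⟨Submodule.Quotient.mk x, hx⟩
    refine ⟨c - π c + t, ?_⟩
    simp [hπ, cokernelDegree_of_torsion, hc]
  · intro x hx
    have hx0 : (Submodule.Quotient.mk x : s.Cokernel) = 0 :=
      (Submodule.Quotient.mk_eq_zero _).2 hx
    change (π.prod s.cokernelDegree) (Submodule.Quotient.mk x) = 0
    rw [hx0, map_zero]

/-- If the basis vectors at the vertices of `S` generate `ℤ^V` modulo the image of `L(G, d)`, then the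
critical group has fewer than `#S` invariant factors: reducing modulo a prime divisor `p` of the
first of `k` factors gives a surjection of the cokernel on `𝔽_p ^ k × 𝔽_p`. -/
theorem lt_card_of_span_sup_range_eq_top (s : ArithmeticalStructure G) (S : Finset V)
    (hS : Submodule.span ℤ ((fun v => (Pi.single v 1 : V → ℤ)) '' S) ⊔
      LinearMap.range s.matrix.mulVecLin = ⊤)
    {k : ℕ} (hk : 0 < k) {a : Fin k → ℕ} (ha : IsInvariantFactorDecomposition s.CriticalGroup a) :
    k < S.card := by
  obtain ⟨e⟩ := ha.equiv
  obtain ⟨f, hf, hker⟩ := s.exists_surjective_prod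
  obtain ⟨p, hp, hpa⟩ := Nat.exists_prime_and_dvd (ha.one_lt ⟨0, hk⟩).ne'
  have : Fact p.Prime := ⟨hp⟩
  have hpi : ∀ i, p ∣ a i := fun i => hpa.trans (ha.dvd _ _ (Nat.zero_le i))
  let q : ((i : Fin k) → ZMod (a i)) →+ (Fin k → ZMod p) :=
    AddMonoidHom.mk' (fun x i => ZMod.castHom (hpi i) (ZMod p) (x i))
      (fun x y => by funext i; simp only [Pi.add_apply, map_add])
  have hq : Function.Surjective q := fun y =>
    ⟨fun i => (ZMod.castHom_surjective (hpi i) (y i)).choose,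
      funext fun i => (ZMod.castHom_surjective (hpi i) (y i)).choose_spec⟩
  let F : (V → ℤ) →+ (Fin k → ZMod p) × ZMod p :=
    ((q.comp e.toAddMonoidHom).prodMap (Int.castAddHom (ZMod p))).comp f.toAddMonoidHom
  have hF : Function.Surjective F :=
    ((hq.comp e.surjective).prodMap ZMod.intCast_surjective).comp hf
  let W : Submodule (ZMod p) ((Fin k → ZMod p) × ZMod p) :=
    Submodule.span (ZMod p) (S.image fun v => F (Pi.single v 1) : Finset _)
  have hW : W = ⊤ := by
    rw [eq_top_iff]
    rintro y -
    obtain ⟨x, rfl⟩ := hF y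
    have hx : x ∈ W.toAddSubgroup.comap F := by
      have hle : Submodule.span ℤ ((fun v => (Pi.single v 1 : V → ℤ)) '' S) ⊔
          LinearMap.range s.matrix.mulVecLin ≤
          AddSubgroup.toIntSubmodule (W.toAddSubgroup.comap F) := by
        refine sup_le (Submodule.span_le.2 ?_) fun z hz => ?_
        · rintro _ ⟨v, hv, rfl⟩
          exact Submodule.subset_span (Finset.mem_coe.2 (Finset.mem_image_of_mem _ hv))
        · have : F z = 0 := by
            have h0 : f z = 0 := hker hz
            change ((q.comp e.toAddMonoidHom).prodMap (Int.castAddHom (ZMod p))) (f z) = 0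
            rw [h0, map_zero]
          change F z ∈ W
          rw [this]; exact W.zero_mem
      exact hle (hS ▸ Submodule.mem_top)
    exact hx
  calc k + 1 = Module.finrank (ZMod p) ((Fin k → ZMod p) × ZMod p) := by simp
    _ = Module.finrank (ZMod p) W := by rw [hW, finrank_top]
    _ ≤ (S.image fun v => F (Pi.single v 1)).card := finrank_span_finset_le_card _
    _ ≤ S.card := Finset.card_image_le

/-- A homomorphism `g` that kills the image of `L(G, d)` and whose target is killed by some `n > 0`
identifies the critical group with its target as soon as, on the vectors of degree zero, it is
surjective with kernel the image of `L(G, d)`. -/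
theorem nonempty_criticalGroup_addEquiv (s : ArithmeticalStructure G) {B : Type*} [AddCommGroup B]
    (g : (V → ℤ) →ₗ[ℤ] B) (hg : LinearMap.range s.matrix.mulVecLin ≤ LinearMap.ker g)
    (n : ℕ) (hn : 0 < n) (hB : ∀ b : B, n • b = 0)
    (hker : ∀ x, s.degree x = 0 → g x = 0 → x ∈ LinearMap.range s.matrix.mulVecLin)
    (hsurj : ∀ b, ∃ x, s.degree x = 0 ∧ g x = b) :
    Nonempty (s.CriticalGroup ≃+ B) := by
  let φ : s.CriticalGroup →ₗ[ℤ] B := Submodule.liftQ _ g hg ∘ₗ Submodule.subtype _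
  refine ⟨(LinearEquiv.ofBijective φ ⟨?_, ?_⟩).toAddEquiv⟩
  · rw [injective_iff_map_eq_zero]
    rintro ⟨c, hc⟩ h
    have hd := s.cokernelDegree_of_torsion ⟨c, hc⟩
    obtain ⟨x, rfl⟩ := Submodule.Quotient.mk_surjective _ c
    exact Subtype.ext ((Submodule.Quotient.mk_eq_zero _).2 (hker x hd h))
  · intro b
    obtain ⟨x, hx, rfl⟩ := hsurj b
    refine ⟨⟨Submodule.Quotient.mk x, ?_⟩, rfl⟩
    refine (Submodule.mem_torsion_iff _).2
      ⟨⟨(n : ℤ), mem_nonZeroDivisors_of_ne_zero (by exact_mod_cast hn.ne')⟩, ?_⟩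
    rw [Submonoid.mk_smul, ← Submodule.Quotient.mk_smul, Submodule.Quotient.mk_eq_zero]
    refine hker _ (by rw [map_smul, hx, smul_zero]) ?_
    rw [map_smul, natCast_zsmul, hB]

end ArithmeticalStructure

/-! ### Generation of the cokernel by basis vectors -/

namespace ArithmeticalStructure

variable {V : Type*} [Fintype V] [DecidableEq V] {G : SimpleGraph V} [DecidableRel G.Adj]

theorem matrix_mulVec_single (s : ArithmeticalStructure G) (v : V) :
    s.matrix.mulVec (Pi.single v 1) =
      (s.d v : ℤ) • Pi.single v 1 - ∑ u ∈ G.neighborFinset v, Pi.single u 1 := by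
  funext w
  rw [matrix_mulVec_apply]
  simp only [Pi.sub_apply, Pi.smul_apply, Finset.sum_apply, Pi.single_apply, smul_eq_mul,
    Finset.sum_ite_eq, SimpleGraph.mem_neighborFinset, mul_ite, mul_one, mul_zero,
    Finset.sum_ite_eq']
  congr 1
  · split_ifs with h
    · rw [h]
    · rfl
  · simp only [G.adj_comm]

/-- Modulo the image of `L(G, d)`, the basis vector at a neighbour `u` of `v` is a combination of
the basis vectors at `v` and at its other neighbours. -/
theorem single_mem_of_neighbors (s : ArithmeticalStructure G) {W : Submodule ℤ (V → ℤ)}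
    (hW : LinearMap.range s.matrix.mulVecLin ≤ W) {u v : V} (huv : G.Adj v u)
    (hv : Pi.single v 1 ∈ W) (h : ∀ w, G.Adj v w → w ≠ u → Pi.single w 1 ∈ W) :
    Pi.single u 1 ∈ W := by
  have hL : s.matrix.mulVec (Pi.single v 1) ∈ W := hW ⟨_, rfl⟩
  rw [matrix_mulVec_single, ← Finset.add_sum_erase _ _ ((G.mem_neighborFinset v u).2 huv)] at hL
  have hsum : ∑ w ∈ (G.neighborFinset v).erase u, (Pi.single w 1 : V → ℤ) ∈ W :=
    W.sum_mem fun w hw => by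
      rw [Finset.mem_erase, SimpleGraph.mem_neighborFinset] at hw
      exact h w hw.2 hw.1
  have := W.sub_mem (W.sub_mem (W.smul_mem (s.d v : ℤ) hv) hsum) hL
  convert this using 1
  abel

theorem eq_top_of_single_mem {W : Submodule ℤ (V → ℤ)} (h : ∀ v, Pi.single v 1 ∈ W) : W = ⊤ := by
  rw [eq_top_iff, ← (Pi.basisFun ℤ V).span_eq, Submodule.span_le]
  rintro _ ⟨v, rfl⟩
  simpa using h v

/-! ### Complete graphs and star graphs -/

theorem card_le_of_complete {n : ℕ} (hn : 2 ≤ n)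
    (s : ArithmeticalStructure (⊤ : SimpleGraph (Fin n))) {k : ℕ} {a : Fin k → ℕ}
    (ha : IsInvariantFactorDecomposition s.CriticalGroup a) : k ≤ n - 2 := by
  obtain ⟨m, rfl⟩ : ∃ m, n = m + 2 := ⟨n - 2, by omega⟩
  rcases Nat.eq_zero_or_pos k with rfl | hk
  · exact Nat.zero_le _
  have hcard : (Finset.univ.erase (1 : Fin (m + 2))).card = m + 1 := by simp
  have := s.lt_card_of_span_sup_range_eq_top (Finset.univ.erase 1) ?_ hk ha
  · omega
  refine eq_top_of_single_mem fun v => ?_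
  have hS : ∀ w ≠ 1, Pi.single w 1 ∈
      Submodule.span ℤ ((fun v => (Pi.single v 1 : Fin (m + 2) → ℤ)) ''
        (Finset.univ.erase (1 : Fin (m + 2)) : Finset _)) ⊔ LinearMap.range s.matrix.mulVecLin :=
    fun w hw => Submodule.mem_sup_left (Submodule.subset_span ⟨w, by simpa using hw, rfl⟩)
  by_cases hv : v = 1
  · subst hv
    exact s.single_mem_of_neighbors le_sup_right (v := 0) (by simp) (hS 0 (by simp))
      fun w _ hw => hS w hw
  · exact hS v hv

theorem card_le_of_star {n : ℕ} (hn : 2 ≤ n)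
    (s : ArithmeticalStructure (SimpleGraph.starGraph (0 : Fin (n + 1)))) {k : ℕ} {a : Fin k → ℕ}
    (ha : IsInvariantFactorDecomposition s.CriticalGroup a) : k ≤ n - 2 := by
  obtain ⟨m, rfl⟩ : ∃ m, n = m + 2 := ⟨n - 2, by omega⟩
  rcases Nat.eq_zero_or_pos k with rfl | hk
  · exact Nat.zero_le _
  have h20 : (2 : Fin (m + 2 + 1)) ≠ 0 := by
    simp [Fin.ext_iff, Nat.mod_eq_of_lt (show 2 < m + 2 + 1 by omega)]
  have h12 : (1 : Fin (m + 2 + 1)) ≠ 2 := by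
    simp [Fin.ext_iff, Nat.mod_eq_of_lt (show 2 < m + 2 + 1 by omega)]
  have hcard : ((Finset.univ.erase (0 : Fin (m + 2 + 1))).erase 2).card = m + 1 := by
    rw [Finset.card_erase_of_mem (by simpa using h20)]
    simp
  have := s.lt_card_of_span_sup_range_eq_top ((Finset.univ.erase 0).erase 2) ?_ hk ha
  · omega
  refine eq_top_of_single_mem fun v => ?_
  have hS : ∀ w ≠ 0, w ≠ 2 → Pi.single w 1 ∈
      Submodule.span ℤ ((fun v => (Pi.single v 1 : Fin (m + 2 + 1) → ℤ)) ''
        ((Finset.univ.erase (0 : Fin (m + 2 + 1))).erase 2 : Finset _)) ⊔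
        LinearMap.range s.matrix.mulVecLin :=
    fun w h0 h2 => Submodule.mem_sup_left
      (Submodule.subset_span ⟨w, by simp [h0, h2], rfl⟩)
  -- the centre is the only neighbour of the leaf `1`
  have h0 := s.single_mem_of_neighbors le_sup_right (u := 0) (v := 1) (by simp)
    (hS 1 (by simp) h12) fun w hw hw0 => by
      simp [hw0] at hw
  by_cases hv0 : v = 0
  · exact hv0 ▸ h0
  by_cases hv : v = 2
  · subst hv
    exact s.single_mem_of_neighbors le_sup_right (v := 0) (by simp [h20.symm]) h0
      fun w hw hw2 => hS w hw.ne' hw2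
  · exact hS v hv0 hv

/-! ### The two extremal structures -/

theorem neighborFinset_starGraph_zero (n : ℕ) :
    (SimpleGraph.starGraph (0 : Fin (n + 1))).neighborFinset 0 = Finset.univ.erase 0 := by
  ext w
  simp [eq_comm]

theorem neighborFinset_starGraph_of_ne_zero {n : ℕ} {v : Fin (n + 1)} (hv : v ≠ 0) :
    (SimpleGraph.starGraph (0 : Fin (n + 1))).neighborFinset v = {0} := by
  ext w
  simp only [SimpleGraph.mem_neighborFinset, SimpleGraph.starGraph_adj, Finset.mem_singleton]
  grind

/-- The Laplacian arithmetical structure on the complete graph: `d` is the degree of the graph and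
`r` is `1`. -/
def completeLaplacian (n : ℕ) (hn : 0 < n) :
    ArithmeticalStructure (⊤ : SimpleGraph (Fin n)) where
  d _ := n - 1
  r _ := 1
  r_pos _ := one_pos
  r_mul_d v := by
    rw [Finset.sum_const, SimpleGraph.card_neighborFinset_eq_degree,
      SimpleGraph.complete_graph_degree]
    simp
  gcd_r := Nat.dvd_one.1 (Finset.gcd_dvd (Finset.mem_univ (⟨0, hn⟩ : Fin n)))

/-- The arithmetical structure on the star graph with `n` leaves for which `d` is `1` and `r` is `n`
at the centre, while `d` is `n` and `r` is `1` at the leaves. -/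
def starLaplacian (n : ℕ) (hn : 0 < n) :
    ArithmeticalStructure (SimpleGraph.starGraph (0 : Fin (n + 1))) where
  d := Fin.cons 1 fun _ => n
  r := Fin.cons n fun _ => 1
  r_pos v := by
    refine Fin.cases ?_ (fun i => ?_) v <;> simp [hn]
  r_mul_d v := by
    refine Fin.cases ?_ (fun i => ?_) v
    · have h := Finset.add_sum_erase Finset.univ (Fin.cons n fun _ => 1 : Fin (n + 1) → ℕ)
        (Finset.mem_univ 0)
      rw [Fin.sum_univ_succ] at h
      rw [neighborFinset_starGraph_zero, add_left_cancel h]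
      simp
    · simp [neighborFinset_starGraph_of_ne_zero (Fin.succ_ne_zero i)]
  gcd_r := by
    have h := Finset.gcd_dvd (f := (Fin.cons n fun _ => 1 : Fin (n + 1) → ℕ))
      (Finset.mem_univ (Fin.succ ⟨0, hn⟩))
    rw [Fin.cons_succ] at h
    exact Nat.dvd_one.1 h

end ArithmeticalStructure

/-! ### Differences modulo `n` -/

/-- The differences `x i - x 0` modulo `m + 2`, for the `m` indices `i` other than the first and
the last. -/
def diffMod (m : ℕ) : (Fin (m + 2) → ℤ) →ₗ[ℤ] (Fin m → ZMod (m + 2)) :=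
  LinearMap.pi fun j => (Int.castAddHom (ZMod (m + 2))).toIntLinearMap ∘ₗ
    (LinearMap.proj (R := ℤ) (φ := fun _ : Fin (m + 2) => ℤ) j.succ.castSucc -
      LinearMap.proj (R := ℤ) (φ := fun _ : Fin (m + 2) => ℤ) 0)

theorem diffMod_apply (m : ℕ) (x : Fin (m + 2) → ℤ) (j : Fin m) :
    diffMod m x j = ((x j.succ.castSucc - x 0 : ℤ) : ZMod (m + 2)) := rfl

theorem diffMod_eq_zero (m : ℕ) {x : Fin (m + 2) → ℤ} {c : ℤ} {y : Fin (m + 2) → ℤ}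
    (h : ∀ i, x i = (m + 2 : ℕ) * y i + c) : diffMod m x = 0 := by
  funext j
  rw [diffMod_apply, Pi.zero_apply, ZMod.intCast_zmod_eq_zero_iff_dvd, h, h]
  exact ⟨y j.succ.castSucc - y 0, by ring⟩

/-- The missing congruence `x (last) ≡ x 0` follows from the sum, as `-(m + 1) ≡ 1`. -/
theorem exists_eq_of_diffMod_eq_zero (m : ℕ) {x : Fin (m + 2) → ℤ} (hx : diffMod m x = 0)
    (hs : ((m + 2 : ℕ) : ℤ) ∣ ∑ i, x i) :
    ∃ y : Fin (m + 2) → ℤ, ∀ i, x i = (m + 2 : ℕ) * y i + x 0 := by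
  have key : ∀ i : Fin (m + 1), ((m + 2 : ℕ) : ℤ) ∣ x i.castSucc - x 0 := by
    intro i
    refine Fin.cases ?_ (fun j => ?_) i
    · simp
    · have := congrFun hx j
      rwa [diffMod_apply, Pi.zero_apply, ZMod.intCast_zmod_eq_zero_iff_dvd] at this
  have key' : ∀ i, ((m + 2 : ℕ) : ℤ) ∣ x i - x 0 := by
    intro i
    refine Fin.lastCases ?_ key i
    rw [Fin.sum_univ_castSucc] at hs
    have h1 : ((m + 2 : ℕ) : ℤ) ∣ ∑ i : Fin (m + 1), (x i.castSucc - x 0) :=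
      Finset.dvd_sum fun i _ => key i
    rw [Finset.sum_sub_distrib, Finset.sum_const, Finset.card_univ, Fintype.card_fin,
      nsmul_eq_mul] at h1
    have h2 := (hs.sub h1).sub (Dvd.intro (x 0) rfl)
    have h3 : ∀ t u v : ℤ,
        t + u - (t - ((m + 1 : ℕ) : ℤ) * v) - ((m + 2 : ℕ) : ℤ) * v = u - v := by
      intro t u v
      push_cast
      ring
    rwa [h3] at h2
  choose y hy using key'
  exact ⟨y, fun i => by rw [← hy]; ring⟩

theorem exists_diffMod_eq (m : ℕ) (b : Fin m → ZMod (m + 2)) :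
    ∃ x : Fin (m + 2) → ℤ, ∑ i, x i = 0 ∧ diffMod m x = b := by
  choose z hz using fun j => ZMod.intCast_surjective (b j)
  let w : Fin (m + 1) → ℤ := Fin.cons 0 z
  refine ⟨Fin.snoc (α := fun _ => ℤ) w (-∑ i, w i), ?_, ?_⟩
  · rw [Fin.sum_univ_castSucc]
    simp
  · funext j
    have h0 : (Fin.snoc (α := fun _ => ℤ) w (-∑ i, w i) : Fin (m + 2) → ℤ) 0 = 0 := by
      rw [← Fin.castSucc_zero, Fin.snoc_castSucc]
      rfl
    rw [diffMod_apply, h0, Fin.snoc_castSucc, sub_zero, ← hz j]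
    rfl

theorem nsmul_pi_zmod_eq_zero (m n : ℕ) (b : Fin m → ZMod n) : n • b = 0 := by
  funext j
  simp

/-! ### Critical groups of the extremal structures -/

namespace ArithmeticalStructure

theorem completeLaplacian_mulVec (m : ℕ) (x : Fin (m + 2) → ℤ) (v : Fin (m + 2)) :
    (completeLaplacian (m + 2) (by omega)).matrix.mulVec x v =
      (m + 2 : ℕ) * x v - ∑ u, x u := by
  have : (⊤ : SimpleGraph (Fin (m + 2))).neighborFinset v = Finset.univ.erase v := by
    ext w; simp [eq_comm]
  rw [matrix_mulVec_apply, this, Finset.sum_erase_eq_sub (Finset.mem_univ v)]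
  simp only [completeLaplacian, Nat.add_one_sub_one]
  push_cast
  ring

theorem nonempty_criticalGroup_completeLaplacian (m : ℕ) :
    Nonempty ((completeLaplacian (m + 2) (by omega)).CriticalGroup ≃+
      (Fin m → ZMod (m + 2))) := by
  have hdeg : ∀ x, (completeLaplacian (m + 2) (by omega)).degree x = ∑ i, x i := fun x => by
    simp [degree_apply, completeLaplacian]
  refine nonempty_criticalGroup_addEquiv _ (diffMod m) ?_ (m + 2) (by omega)
    (nsmul_pi_zmod_eq_zero _ _) (fun x hx hgx => ?_) fun b => ?_
  · rintro _ ⟨x, rfl⟩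
    exact diffMod_eq_zero m (y := x) (c := -∑ u, x u) fun i => by
      rw [Matrix.mulVecLin_apply, completeLaplacian_mulVec, sub_eq_add_neg]
  · rw [hdeg] at hx
    obtain ⟨y, hy⟩ := exists_eq_of_diffMod_eq_zero m hgx (hx ▸ dvd_zero _)
    -- summing `x i = n * y i + x 0` over the `n` indices gives `∑ y = - x 0`
    have hsum : ∑ i, y i = -x 0 := by
      rw [Finset.sum_congr rfl fun i _ => hy i, Finset.sum_add_distrib, ← Finset.mul_sum,
        Finset.sum_const, Finset.card_univ, Fintype.card_fin, nsmul_eq_mul, ← mul_add] at hx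
      have := (mul_eq_zero.1 hx).resolve_left (by positivity)
      linarith
    refine ⟨y, funext fun i => ?_⟩
    rw [Matrix.mulVecLin_apply, completeLaplacian_mulVec, hsum, hy i]
    ring
  · obtain ⟨x, hx, rfl⟩ := exists_diffMod_eq m b
    exact ⟨x, (hdeg x).trans hx, rfl⟩

theorem starLaplacian_mulVec_zero (n : ℕ) (hn : 0 < n) (x : Fin (n + 1) → ℤ) :
    (starLaplacian n hn).matrix.mulVec x 0 = x 0 - ∑ i : Fin n, x i.succ := by
  rw [matrix_mulVec_apply, neighborFinset_starGraph_zero,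
    Finset.sum_erase_eq_sub (Finset.mem_univ _), Fin.sum_univ_succ]
  simp [starLaplacian]

theorem starLaplacian_mulVec_succ (n : ℕ) (hn : 0 < n) (x : Fin (n + 1) → ℤ) (i : Fin n) :
    (starLaplacian n hn).matrix.mulVec x i.succ = n * x i.succ - x 0 := by
  rw [matrix_mulVec_apply, neighborFinset_starGraph_of_ne_zero (Fin.succ_ne_zero i)]
  simp [starLaplacian]

theorem nonempty_criticalGroup_starLaplacian (m : ℕ) :
    Nonempty ((starLaplacian (m + 2) (by omega)).CriticalGroup ≃+ (Fin m → ZMod (m + 2))) := by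
  have hdeg : ∀ x, (starLaplacian (m + 2) (by omega)).degree x =
      (m + 2 : ℕ) * x 0 + ∑ i : Fin (m + 2), x i.succ := fun x => by
    rw [degree_apply, Fin.sum_univ_succ]
    simp [starLaplacian]
  refine nonempty_criticalGroup_addEquiv _ (diffMod m ∘ₗ LinearMap.funLeft ℤ ℤ Fin.succ) ?_
    (m + 2) (by omega) (nsmul_pi_zmod_eq_zero _ _) (fun x hx hgx => ?_) fun b => ?_
  · rintro _ ⟨x, rfl⟩
    exact diffMod_eq_zero m (y := fun i => x i.succ) (c := -x 0) fun i => by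
      rw [LinearMap.funLeft_apply, Matrix.mulVecLin_apply, starLaplacian_mulVec_succ,
        sub_eq_add_neg]
  · rw [hdeg] at hx
    obtain ⟨y, hy⟩ := exists_eq_of_diffMod_eq_zero m (x := fun i => x i.succ) hgx
      ⟨-x 0, by linarith⟩
    -- summing `x i = n * y i + x 1` over the `n` leaves gives `x 0 = - ∑ y - x 1`
    have hsum : x 0 = -(x (Fin.succ 0)) - ∑ i, y i := by
      rw [Finset.sum_congr rfl fun i _ => hy i, Finset.sum_add_distrib, ← Finset.mul_sum,
        Finset.sum_const, Finset.card_univ, Fintype.card_fin, nsmul_eq_mul, ← mul_add,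
        ← mul_add] at hx
      have := (mul_eq_zero.1 hx).resolve_left (by positivity)
      linarith
    refine ⟨Fin.cons (-(x (Fin.succ 0))) y, funext fun i => ?_⟩
    rw [Matrix.mulVecLin_apply]
    refine Fin.cases ?_ (fun j => ?_) i
    · rw [starLaplacian_mulVec_zero, hsum]
      simp
    · rw [starLaplacian_mulVec_succ, hy j]
      simp
  · obtain ⟨x, hx, rfl⟩ := exists_diffMod_eq m b
    exact ⟨Fin.cons 0 x, by rw [hdeg]; simpa using hx, rfl⟩

end ArithmeticalStructure

theorem proposition4p5 (n : ℕ) (hn : 2 ≤ n) :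
    -- at most `n - 2` invariant factors on the star graph with `n` leaves, centred at `0`
    (∀ s : ArithmeticalStructure (SimpleGraph.starGraph (0 : Fin (n + 1))),
      (∃ (k : ℕ) (a : Fin k → ℕ), IsInvariantFactorDecomposition s.CriticalGroup a) ∧
      ∀ (k : ℕ) (a : Fin k → ℕ), IsInvariantFactorDecomposition s.CriticalGroup a → k ≤ n - 2) ∧
    -- at most `n - 2` invariant factors on the complete graph with `n` vertices
    (∀ s : ArithmeticalStructure (⊤ : SimpleGraph (Fin n)),
      (∃ (k : ℕ) (a : Fin k → ℕ), IsInvariantFactorDecomposition s.CriticalGroup a) ∧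
      ∀ (k : ℕ) (a : Fin k → ℕ), IsInvariantFactorDecomposition s.CriticalGroup a → k ≤ n - 2) ∧
    -- sharpness on the complete graph: the Laplacian structure has critical group `(ℤ/n)^(n-2)`
    (∃ s : ArithmeticalStructure (⊤ : SimpleGraph (Fin n)),
      (∀ v, s.d v = n - 1) ∧ (∀ v, s.r v = 1) ∧
      IsInvariantFactorDecomposition s.CriticalGroup (fun _ : Fin (n - 2) => n)) ∧
    -- sharpness on the star graph: so does the corresponding structure
    (∃ s : ArithmeticalStructure (SimpleGraph.starGraph (0 : Fin (n + 1))),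
      s.d 0 = 1 ∧ (∀ i : Fin n, s.d i.succ = n) ∧
      s.r 0 = n ∧ (∀ i : Fin n, s.r i.succ = 1) ∧
      IsInvariantFactorDecomposition s.CriticalGroup (fun _ : Fin (n - 2) => n)) := by
  obtain ⟨m, rfl⟩ : ∃ m, n = m + 2 := ⟨n - 2, by omega⟩
  refine ⟨fun s => ⟨exists_invariantFactors_of_finite _,
      fun k a => ArithmeticalStructure.card_le_of_star hn s⟩,
    fun s => ⟨exists_invariantFactors_of_finite _,
      fun k a => ArithmeticalStructure.card_le_of_complete hn s⟩,
    ⟨ArithmeticalStructure.completeLaplacian (m + 2) (by omega),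
      fun _ => rfl, fun _ => rfl, fun _ => hn,
      fun _ _ _ => dvd_rfl, ArithmeticalStructure.nonempty_criticalGroup_completeLaplacian m⟩,
    ⟨ArithmeticalStructure.starLaplacian (m + 2) (by omega),
      rfl, fun _ => rfl, rfl, fun _ => rfl, fun _ => hn,
      fun _ _ _ => dvd_rfl, ArithmeticalStructure.nonempty_criticalGroup_starLaplacian m⟩⟩
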